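/- Let $D,E\geq 1$ be integers with $D\neq E$. Let $\alpha$ and $\beta$ be the uniform (normalized surface) probability measures on the unit spheres of $\mathbb{R}^D$ and $\mathbb{R}^E$, seen as measures on $\mathbb{R}^D$ and $\mathbb{R}^E$, which are endowed with the squared Euclidean costs $c_X(x,x')=\|x-x'\|^2$ and $c_Y(y,y')=\|y-y'\|^2$. For probability measures $\mu,\nu$ on spaces $U,V$ with costs $c_U,c_V$ and for $\varepsilon>0$, let $$\mathrm{GW}_\varepsilon(\mu,\nu)=\inf_{\pi\in\Pi(\mu,\nu)}\ \iint \bigl(c_U(u,u')-c_V(v,v')\bigr)^2\,d\pi(u,v)\,d\pi(u',v')+\varepsilon\,\mathrm{KL}(\pi\,|\,\mu\otimes\nu),$$ where $\Pi(\mu,\nu)$ is the set of couplings of $\mu$ and $\nu$ and $\mathrm{KL}$ is the Kullback–Leibler divergence, and let $$\mathrm{SGW}_\varepsilon(\mu,\nu)=\mathrm{GW}_\varepsilon(\mu,\nu)-\tfrac12\bigl(\mathrm{GW}_\varepsilon(\mu,\mu)+\mathrm{GW}_\varepsilon(\nu,\nu)\bigr).$$ Call $\mu$ and $\nu$ isometric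 if there is a bijection $I:\operatorname{supp}\mu\to\operatorname{supp}\nu$ with $c_U(u,u')=c_V(I(u),I(u'))$ for all $u,u'\in\operatorname{supp}\mu$ and $I_\sharp\mu=\nu$. Then $\alpha$ and $\beta$ are not isometric, but there exists $\varepsilon_0>0$ such that $\mathrm{GW}_\varepsilon(\alpha,\beta)$, $\mathrm{GW}_\varepsilon(\alpha,\alpha)$ and $\mathrm{GW}_\varepsilon(\beta,\beta)$ are finite and $\mathrm{SGW}_\varepsilon(\alpha,\beta)=0$ for every $\varepsilon>\varepsilon_0$. -/

import Mathlib

open MeasureTheory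
open scoped ENNReal

noncomputable section

namespace SinkhornGW

variable {X Y : Type*} [MeasurableSpace X] [MeasurableSpace Y]

/-- The set `Π(α, β)` of couplings of `α` and `β`: measures on the product with marginals
`α` and `β`. -/
def couplings (α : Measure X) (β : Measure Y) : Set (Measure (X × Y)) :=
  {π | π.map Prod.fst = α ∧ π.map Prod.snd = β}

/-- The Gromov-Wasserstein loss
`L(π) = ∫ (cX(x, x') - cY(y, y'))² dπ(x, y) dπ(x', y')`, with values in `[0, ∞]`. -/
def gwLoss (cX : X → X → ℝ) (cY : Y → Y → ℝ) (π : Measure (X × Y)) : ℝ≥0∞ :=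
  ∫⁻ z, ENNReal.ofReal ((cX z.1.1 z.2.1 - cY z.1.2 z.2.2) ^ 2) ∂(π.prod π)

/-- The entropic Gromov-Wasserstein value
`GW_ε(α, β) = inf_{π ∈ Π(α, β)} L(π) + ε KL(π | α ⊗ β)`, with values in `[0, ∞]`. -/
def entropicGW (cX : X → X → ℝ) (cY : Y → Y → ℝ) (ε : ℝ) (α : Measure X) (β : Measure Y) :
    ℝ≥0∞ :=
  ⨅ π ∈ couplings α β,
    gwLoss cX cY π + ENNReal.ofReal ε * InformationTheory.klDiv π (α.prod β)

/-- The Sinkhorn Gromov-Wasserstein divergence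
`SGW_ε(α, β) = GW_ε(α, β) - ½ (GW_ε(α, α) + GW_ε(β, β))`.
It is computed in the extended reals, where `⊤ - ⊤ = ⊥`; hence an equality `SGW_ε(α, β) = r`
with `r` real says in particular that the three values of `GW_ε` are finite. -/
def sinkhornGW (cX : X → X → ℝ) (cY : Y → Y → ℝ) (ε : ℝ) (α : Measure X) (β : Measure Y) :
    EReal :=
  (entropicGW cX cY ε α β : EReal) -
    ((1 / 2 : ℝ) : EReal) *
      ((entropicGW cX cX ε α α : EReal) + (entropicGW cY cY ε β β : EReal))

/-- `α` and `β` are isometric (with respect to the costs `cX` and `cY`): there is a bijection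
`I` from the support of `α` onto the support of `β` that preserves the costs and pushes `α`
forward to `β` (both being restricted to their supports). -/
def AreIsometric [TopologicalSpace X] [TopologicalSpace Y]
    (cX : X → X → ℝ) (cY : Y → Y → ℝ) (α : Measure X) (β : Measure Y) : Prop :=
  ∃ I : α.support ≃ β.support,
    (∀ x x' : α.support, cX x x' = cY (I x) (I x')) ∧
      MeasurePreserving I (α.comap Subtype.val) (β.comap Subtype.val)

/-- The squared Euclidean cost `c(x, x') = ‖x - x'‖²` on `ℝ^D`. -/
def sqEuclidean (D : ℕ) (x x' : EuclideanSpace ℝ (Fin D)) : ℝ := ‖x - x'‖ ^ 2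

/-- The uniform probability measure on the unit sphere of `ℝ^D` (`1 ≤ D`): the surface measure
normalized to total mass one, seen as a measure on `ℝ^D`. -/
def uniformSphere (D : ℕ) : Measure (EuclideanSpace ℝ (Fin D)) :=
  let σ : Measure (Metric.sphere (0 : EuclideanSpace ℝ (Fin D)) 1) := volume.toSphere
  ((σ Set.univ)⁻¹ • σ).map Subtype.val

end SinkhornGW

end

/-! On unit vectors the squared distance is `2 - 2⟨x, x'⟩`. Expanding the square therefore splits
the loss into `4` times the second moments of the marginals, which do not depend on the coupling,
minus `8` times the squared Frobenius norm of the cross-moment matrix (`gwLoss_eq_ofReal`). For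
centered measures the product coupling has zero cross-moments and zero entropy. A Pinsker-type bound
controls each cross-moment by the entropy, so for large `ε` the penalty outweighs any gain and the
product is optimal (`entropicGW_eq_ofReal`). The optimal value is then a sum of one term per
marginal, and the divergence cancels. An isometry of the supports preserves inner products, so it
carries an orthonormal basis to an orthonormal family; applied both ways, this forces equal
dimensions. -/

open InformationTheory

/-! ### Entropy bounds for means of bounded functions -/

section Entropy

/-- Young's inequality for the pair of convex conjugate functions `klFun` and `exp - 1`. -/
theorem mul_le_klFun_add_exp_sub_one {t : ℝ} (ht : 0 ≤ t) (s : ℝ) :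
    t * s ≤ klFun t + (Real.exp s - 1) := by
  rw [klFun_apply]
  rcases ht.eq_or_lt with rfl | ht
  · simpa using (Real.exp_pos s).le
  · have h := Real.log_le_sub_one_of_pos (div_pos (Real.exp_pos s) ht)
    rw [Real.log_div (Real.exp_pos s).ne' ht.ne', Real.log_exp] at h
    have h' := mul_le_mul_of_nonneg_left h ht.le
    have : t * (Real.exp s / t - 1) = Real.exp s - t := by field_simp
    linarith

/-- A Pinsker-type inequality: the square of the mean under `μ` of a function bounded by `1` and
centered under `ν` is at most `4 KL(μ | ν)`. -/
theorem sq_integral_le_four_mul_toReal_klDiv {Ω : Type*} [MeasurableSpace Ω] {μ ν : Measure Ω}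
    [IsProbabilityMeasure μ] [IsProbabilityMeasure ν] (h : klDiv μ ν ≠ ∞) {g : Ω → ℝ}
    (hg : Measurable g) (hb : ∀ᵐ x ∂ν, |g x| ≤ 1) (h0 : ∫ x, g x ∂ν = 0) :
    (∫ x, g x ∂μ) ^ 2 ≤ 4 * (klDiv μ ν).toReal := by
  obtain ⟨hac, hint⟩ := klDiv_ne_top_iff.mp h
  set m := ∫ x, g x ∂μ
  have hmb : |m| ≤ 1 := by
    have := norm_integral_le_of_norm_le_const (μ := μ) (f := g) (C := 1) (hac.ae_le hb)
    simpa using this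
  have hgν : Integrable g ν := Integrable.of_bound hg.aestronglyMeasurable 1 hb
  have hgμ : Integrable g μ := Integrable.of_bound hg.aestronglyMeasurable 1 (hac.ae_le hb)
  have hrn : Integrable (fun x => (μ.rnDeriv ν x).toReal * g x) ν := by
    simpa [smul_eq_mul] using (integrable_rnDeriv_smul_iff hac (f := g)).mpr hgμ
  have hrn' : ∫ x, (μ.rnDeriv ν x).toReal * g x ∂ν = m := by
    simpa [smul_eq_mul] using integral_rnDeriv_smul hac (f := g)
  have hkl : Integrable (fun x => klFun (μ.rnDeriv ν x).toReal) ν :=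
    (integrable_klFun_rnDeriv_iff hac).mpr hint
  have hlin : Integrable (fun x => m / 2 * g x + (m / 2) ^ 2) ν :=
    (hgν.const_mul _).add (integrable_const _)
  -- Young's inequality at `s = c * g x`, with `exp s - 1 ≤ s + s ^ 2` for `|s| ≤ 1`, gives `c * m ≤
  -- KL + c ^ 2` since `g` is centered; `c = m / 2` is the optimal choice.
  have key : ∫ x, m / 2 * ((μ.rnDeriv ν x).toReal * g x) ∂ν ≤
      ∫ x, (klFun (μ.rnDeriv ν x).toReal + (m / 2 * g x + (m / 2) ^ 2)) ∂ν := by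
    refine integral_mono_ae (hrn.const_mul _) (hkl.add hlin) ?_
    filter_upwards [hb] with x hx
    have hs : |m / 2 * g x| ≤ 1 := by
      rw [abs_mul, abs_div, abs_two]
      nlinarith [abs_nonneg m, abs_nonneg (g x)]
    have h1 := mul_le_klFun_add_exp_sub_one (t := (μ.rnDeriv ν x).toReal)
      ENNReal.toReal_nonneg (m / 2 * g x)
    have h2 := (abs_le.mp (Real.abs_exp_sub_one_sub_id_le hs)).2
    have h3 : (g x) ^ 2 ≤ 1 := (sq_le_one_iff_abs_le_one _).mpr hx
    nlinarith [mul_le_mul_of_nonneg_left h3 (sq_nonneg (m / 2))]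
  have e1 : ∫ x, (klFun (μ.rnDeriv ν x).toReal + (m / 2 * g x + (m / 2) ^ 2)) ∂ν =
      (klDiv μ ν).toReal + (m / 2) ^ 2 := by
    rw [integral_add hkl hlin,
      integral_add (hgν.const_mul _) (integrable_const _), integral_const_mul, h0,
      toReal_klDiv_eq_integral_klFun hac]
    simp
  rw [integral_const_mul, hrn', e1] at key
  nlinarith

end Entropy

namespace SinkhornGW

section Coordinates

variable {d e : ℕ}

theorem abs_coord_le_one {x : EuclideanSpace ℝ (Fin d)} (hx : ‖x‖ = 1) (i : Fin d) :
    |x i| ≤ 1 := by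
  simpa [hx] using PiLp.norm_apply_le x i

theorem sqEuclidean_eq_of_norm_eq_one {x x' : EuclideanSpace ℝ (Fin d)} (hx : ‖x‖ = 1)
    (hx' : ‖x'‖ = 1) : sqEuclidean d x x' = 2 - 2 * inner ℝ x x' := by
  rw [sqEuclidean, norm_sub_sq_real, hx, hx']
  ring

theorem inner_mul_inner_eq_sum (x x' : EuclideanSpace ℝ (Fin d))
    (y y' : EuclideanSpace ℝ (Fin e)) :
    inner ℝ x x' * inner ℝ y y' = ∑ i, ∑ j, (x i * y j) * (x' i * y' j) := by
  simp only [PiLp.inner_apply, RCLike.inner_apply, conj_trivial, Finset.sum_mul_sum]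
  refine Finset.sum_congr rfl fun i _ => Finset.sum_congr rfl fun j _ => by ring

end Coordinates

/-- The second moment `∬ ⟨x, x'⟩² dα(x) dα(x')`. -/
noncomputable def innerSecondMoment {d : ℕ} (α : Measure (EuclideanSpace ℝ (Fin d))) : ℝ :=
  ∫ p, (inner ℝ p.1 p.2) ^ 2 ∂(α.prod α)

theorem innerSecondMoment_nonneg {d : ℕ} (α : Measure (EuclideanSpace ℝ (Fin d))) :
    0 ≤ innerSecondMoment α :=
  integral_nonneg fun _ => sq_nonneg _

/-- The sum of the squared entries of the cross-moment matrix of `π`. -/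
noncomputable def crossMomentSq {d e : ℕ}
    (π : Measure (EuclideanSpace ℝ (Fin d) × EuclideanSpace ℝ (Fin e))) : ℝ :=
  ∑ i, ∑ j, (∫ z, z.1 i * z.2 j ∂π) ^ 2

/-! ### The loss and its minimizer on unit spheres -/

section Couplings

variable {d e : ℕ} {α : Measure (EuclideanSpace ℝ (Fin d))}
  {β : Measure (EuclideanSpace ℝ (Fin e))}
  {π : Measure (EuclideanSpace ℝ (Fin d) × EuclideanSpace ℝ (Fin e))}

theorem isProbabilityMeasure_of_mem_couplings [IsProbabilityMeasure α] (hπ : π ∈ couplings α β) :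
    IsProbabilityMeasure π := by
  constructor
  have h : (π.map Prod.fst) Set.univ = 1 := by rw [hπ.1]; exact measure_univ
  rwa [Measure.map_apply measurable_fst MeasurableSet.univ, Set.preimage_univ] at h

theorem prod_mem_couplings [IsProbabilityMeasure α] [IsProbabilityMeasure β] :
    α.prod β ∈ couplings α β := by
  simp [couplings]

theorem ae_norm_eq_one_of_mem_couplings (hα : ∀ᵐ x ∂α, ‖x‖ = 1) (hβ : ∀ᵐ y ∂β, ‖y‖ = 1)
    (hπ : π ∈ couplings α β) : ∀ᵐ z ∂π, ‖z.1‖ = 1 ∧ ‖z.2‖ = 1 := by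
  rw [← hπ.1] at hα
  rw [← hπ.2] at hβ
  filter_upwards [ae_of_ae_map measurable_fst.aemeasurable hα,
    ae_of_ae_map measurable_snd.aemeasurable hβ] with z h1 h2 using ⟨h1, h2⟩

theorem gwLoss_eq_ofReal [IsProbabilityMeasure α]
    (hα : ∀ᵐ x ∂α, ‖x‖ = 1) (hβ : ∀ᵐ y ∂β, ‖y‖ = 1) (hπ : π ∈ couplings α β) :
    gwLoss (sqEuclidean d) (sqEuclidean e) π =
      ENNReal.ofReal (4 * innerSecondMoment α + 4 * innerSecondMoment β
        - 8 * crossMomentSq π) := by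
  have := isProbabilityMeasure_of_mem_couplings hπ
  have hz := ae_norm_eq_one_of_mem_couplings hα hβ hπ
  have hz1 : ∀ᵐ p ∂π.prod π, ‖p.1.1‖ = 1 ∧ ‖p.1.2‖ = 1 :=
    Measure.quasiMeasurePreserving_fst.ae hz
  have hz2 : ∀ᵐ p ∂π.prod π, ‖p.2.1‖ = 1 ∧ ‖p.2.2‖ = 1 :=
    Measure.quasiMeasurePreserving_snd.ae hz
  have hcoord : ∀ i j, Integrable (fun z : EuclideanSpace ℝ (Fin d) × EuclideanSpace ℝ (Fin e) =>
      z.1 i * z.2 j) π := by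
    intro i j
    refine Integrable.of_bound (Measurable.aestronglyMeasurable (by fun_prop)) 1 ?_
    filter_upwards [hz] with z hz
    rw [Real.norm_eq_abs, abs_mul]
    exact mul_le_one₀ (abs_coord_le_one hz.1 i) (abs_nonneg _) (abs_coord_le_one hz.2 j)
  have hprod : ∀ i j, Integrable (fun p : (EuclideanSpace ℝ (Fin d) × EuclideanSpace ℝ (Fin e)) ×
      (EuclideanSpace ℝ (Fin d) × EuclideanSpace ℝ (Fin e)) =>
      (p.1.1 i * p.1.2 j) * (p.2.1 i * p.2.2 j)) (π.prod π) :=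
    fun i j => (hcoord i j).mul_prod (hcoord i j)
  have hI1 : Integrable (fun p : (EuclideanSpace ℝ (Fin d) × EuclideanSpace ℝ (Fin e)) ×
      (EuclideanSpace ℝ (Fin d) × EuclideanSpace ℝ (Fin e)) =>
      (inner ℝ p.1.1 p.2.1) ^ 2) (π.prod π) := by
    refine Integrable.of_bound (Measurable.aestronglyMeasurable (by fun_prop)) 1 ?_
    filter_upwards [hz1, hz2] with p h1 h2
    have := abs_real_inner_le_norm p.1.1 p.2.1
    rw [h1.1, h2.1, one_mul] at this
    rw [Real.norm_eq_abs, abs_pow]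
    exact pow_le_one₀ (abs_nonneg _) this
  have hI2 : Integrable (fun p : (EuclideanSpace ℝ (Fin d) × EuclideanSpace ℝ (Fin e)) ×
      (EuclideanSpace ℝ (Fin d) × EuclideanSpace ℝ (Fin e)) =>
      (inner ℝ p.1.2 p.2.2) ^ 2) (π.prod π) := by
    refine Integrable.of_bound (Measurable.aestronglyMeasurable (by fun_prop)) 1 ?_
    filter_upwards [hz1, hz2] with p h1 h2
    have := abs_real_inner_le_norm p.1.2 p.2.2
    rw [h1.2, h2.2, one_mul] at this
    rw [Real.norm_eq_abs, abs_pow]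
    exact pow_le_one₀ (abs_nonneg _) this
  have hS := integrable_finsetSum Finset.univ fun i _ =>
    integrable_finsetSum Finset.univ fun j _ => hprod i j
  have hm1 : ∫ p, (inner ℝ p.1.1 p.2.1) ^ 2 ∂(π.prod π) = innerSecondMoment α := by
    rw [innerSecondMoment, ← hπ.1, Measure.map_prod_map _ _ measurable_fst measurable_fst,
      integral_map (by fun_prop) (Measurable.aestronglyMeasurable (by fun_prop))]
    rfl
  have hm2 : ∫ p, (inner ℝ p.1.2 p.2.2) ^ 2 ∂(π.prod π) = innerSecondMoment β := by
    rw [innerSecondMoment, ← hπ.2, Measure.map_prod_map _ _ measurable_snd measurable_snd,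
      integral_map (by fun_prop) (Measurable.aestronglyMeasurable (by fun_prop))]
    rfl
  have hm3 : ∫ p : (EuclideanSpace ℝ (Fin d) × EuclideanSpace ℝ (Fin e)) ×
      (EuclideanSpace ℝ (Fin d) × EuclideanSpace ℝ (Fin e)),
      ∑ i, ∑ j, (p.1.1 i * p.1.2 j) * (p.2.1 i * p.2.2 j) ∂(π.prod π) = crossMomentSq π := by
    rw [crossMomentSq, integral_finsetSum _ fun i _ =>
      integrable_finsetSum Finset.univ fun j _ => hprod i j]
    refine Finset.sum_congr rfl fun i _ => ?_
    rw [integral_finsetSum _ fun j _ => hprod i j]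
    refine Finset.sum_congr rfl fun j _ => ?_
    rw [integral_prod_mul (fun z : EuclideanSpace ℝ (Fin d) × EuclideanSpace ℝ (Fin e) =>
      z.1 i * z.2 j) (fun z : EuclideanSpace ℝ (Fin d) × EuclideanSpace ℝ (Fin e) =>
      z.1 i * z.2 j), sq]
  have hI : Integrable (fun p : (EuclideanSpace ℝ (Fin d) × EuclideanSpace ℝ (Fin e)) ×
      (EuclideanSpace ℝ (Fin d) × EuclideanSpace ℝ (Fin e)) =>
      4 * (inner ℝ p.1.1 p.2.1) ^ 2 + 4 * (inner ℝ p.1.2 p.2.2) ^ 2) (π.prod π) :=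
    (hI1.const_mul 4).add (hI2.const_mul 4)
  have hae : (fun p : (EuclideanSpace ℝ (Fin d) × EuclideanSpace ℝ (Fin e)) ×
      (EuclideanSpace ℝ (Fin d) × EuclideanSpace ℝ (Fin e)) =>
      (sqEuclidean d p.1.1 p.2.1 - sqEuclidean e p.1.2 p.2.2) ^ 2) =ᵐ[π.prod π]
      fun p => 4 * (inner ℝ p.1.1 p.2.1) ^ 2 + 4 * (inner ℝ p.1.2 p.2.2) ^ 2
        - 8 * ∑ i, ∑ j, (p.1.1 i * p.1.2 j) * (p.2.1 i * p.2.2 j) := by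
    filter_upwards [hz1, hz2] with p h1 h2
    rw [sqEuclidean_eq_of_norm_eq_one h1.1 h2.1, sqEuclidean_eq_of_norm_eq_one h1.2 h2.2,
      ← inner_mul_inner_eq_sum]
    ring
  rw [gwLoss, ← ofReal_integral_eq_lintegral_ofReal ((hI.sub (hS.const_mul 8)).congr hae.symm)
    (Filter.Eventually.of_forall fun _ => sq_nonneg _), integral_congr_ae hae,
    integral_sub hI (hS.const_mul 8),
    integral_add (hI1.const_mul 4) (hI2.const_mul 4), integral_const_mul, integral_const_mul,
    integral_const_mul, hm1, hm2, hm3]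

theorem crossMomentSq_prod_eq_zero [SFinite α] [SFinite β]
    (hα0 : ∀ i, ∫ x, x i ∂α = 0) : crossMomentSq (α.prod β) = 0 := by
  refine Finset.sum_eq_zero fun i _ => Finset.sum_eq_zero fun j _ => ?_
  rw [integral_prod_mul (fun x : EuclideanSpace ℝ (Fin d) => x i)
    (fun y : EuclideanSpace ℝ (Fin e) => y j), hα0 i]
  simp

theorem crossMomentSq_le_klDiv [IsProbabilityMeasure α] [IsProbabilityMeasure β]
    (hα : ∀ᵐ x ∂α, ‖x‖ = 1) (hβ : ∀ᵐ y ∂β, ‖y‖ = 1) (hα0 : ∀ i, ∫ x, x i ∂α = 0)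
    (hπ : π ∈ couplings α β) (hkl : klDiv π (α.prod β) ≠ ∞) :
    crossMomentSq π ≤ d * e * (4 * (klDiv π (α.prod β)).toReal) := by
  have := isProbabilityMeasure_of_mem_couplings hπ
  have hz := ae_norm_eq_one_of_mem_couplings hα hβ (prod_mem_couplings (α := α) (β := β))
  have h : ∀ i j, (∫ z, z.1 i * z.2 j ∂π) ^ 2 ≤ 4 * (klDiv π (α.prod β)).toReal := by
    intro i j
    refine sq_integral_le_four_mul_toReal_klDiv hkl (by fun_prop) ?_ ?_
    · filter_upwards [hz] with z hz
      rw [abs_mul]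
      exact mul_le_one₀ (abs_coord_le_one hz.1 i) (abs_nonneg _) (abs_coord_le_one hz.2 j)
    · rw [integral_prod_mul (fun x : EuclideanSpace ℝ (Fin d) => x i)
        (fun y : EuclideanSpace ℝ (Fin e) => y j), hα0 i, zero_mul]
  refine (Finset.sum_le_sum fun i _ => Finset.sum_le_sum fun j _ => h i j).trans_eq ?_
  simp only [Finset.sum_const, Finset.card_univ, Fintype.card_fin, nsmul_eq_mul]
  ring

/-- For `ε ≥ 32 d e`, the product coupling of two centered measures on unit spheres is optimal. -/
theorem entropicGW_eq_ofReal [IsProbabilityMeasure α] [IsProbabilityMeasure β]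
    (hα : ∀ᵐ x ∂α, ‖x‖ = 1) (hβ : ∀ᵐ y ∂β, ‖y‖ = 1) (hα0 : ∀ i, ∫ x, x i ∂α = 0)
    {ε : ℝ} (hε0 : 0 < ε) (hε : 32 * (d * e) ≤ ε) :
    entropicGW (sqEuclidean d) (sqEuclidean e) ε α β =
      ENNReal.ofReal (4 * innerSecondMoment α + 4 * innerSecondMoment β) := by
  refine le_antisymm ?_ ?_
  · refine (iInf₂_le _ prod_mem_couplings).trans_eq ?_
    rw [klDiv_self, mul_zero, add_zero, gwLoss_eq_ofReal hα hβ prod_mem_couplings,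
      crossMomentSq_prod_eq_zero hα0, mul_zero, sub_zero]
  · refine le_iInf₂ fun π hπ => ?_
    by_cases hkl : klDiv π (α.prod β) = ∞
    · rw [hkl, ENNReal.mul_top (by simpa using hε0)]
      simp
    · rw [gwLoss_eq_ofReal hα hβ hπ, ← ENNReal.ofReal_toReal hkl,
        ← ENNReal.ofReal_mul hε0.le]
      refine le_trans (ENNReal.ofReal_le_ofReal ?_) ENNReal.ofReal_add_le
      -- The possible gain `8 * crossMomentSq π` is at most `8 * 4 * d * e * KL`, whence the
      -- threshold `32 * (d * e)`.
      have h1 := crossMomentSq_le_klDiv hα hβ hα0 hπ hkl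
      have h2 := mul_le_mul_of_nonneg_right hε
        (ENNReal.toReal_nonneg (a := klDiv π (α.prod β)))
      linarith

/-- The bound `32 * (d + e) ^ 2` dominates the three thresholds, for `d * e`, `d * d` and `e * e`,
at once. -/
theorem sinkhornGW_eq_zero [IsProbabilityMeasure α] [IsProbabilityMeasure β]
    (hα : ∀ᵐ x ∂α, ‖x‖ = 1) (hβ : ∀ᵐ y ∂β, ‖y‖ = 1) (hα0 : ∀ i, ∫ x, x i ∂α = 0)
    (hβ0 : ∀ i, ∫ y, y i ∂β = 0) {ε : ℝ} (hε0 : 0 < ε) (hε : 32 * (d + e) ^ 2 ≤ ε) :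
    sinkhornGW (sqEuclidean d) (sqEuclidean e) ε α β = 0 := by
  have hd : (0 : ℝ) ≤ d := d.cast_nonneg
  have he : (0 : ℝ) ≤ e := e.cast_nonneg
  have hA := innerSecondMoment_nonneg α
  have hB := innerSecondMoment_nonneg β
  rw [sinkhornGW, entropicGW_eq_ofReal hα hβ hα0 hε0 (by nlinarith [mul_nonneg hd he]),
    entropicGW_eq_ofReal hα hα hα0 hε0 (by nlinarith [mul_nonneg hd he]),
    entropicGW_eq_ofReal hβ hβ hβ0 hε0 (by nlinarith [mul_nonneg hd he]),
    EReal.coe_ennreal_ofReal, EReal.coe_ennreal_ofReal, EReal.coe_ennreal_ofReal,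
    max_eq_left (by positivity), max_eq_left (by positivity), max_eq_left (by positivity),
    ← EReal.coe_add, ← EReal.coe_mul, ← EReal.coe_sub, ← EReal.coe_zero]
  congr 1
  ring

end Couplings

/-! ### The uniform measure on the sphere and its isometries -/

section UniformSphere

open Metric

variable {d : ℕ}

theorem isProbabilityMeasure_uniformSphere (hd : 1 ≤ d) :
    IsProbabilityMeasure (uniformSphere d) := by
  have : Nonempty (Fin d) := ⟨⟨0, hd⟩⟩
  constructor
  rw [uniformSphere, Measure.map_apply measurable_subtype_coe MeasurableSet.univ,
    Set.preimage_univ, Measure.smul_apply, smul_eq_mul]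
  exact ENNReal.inv_mul_cancel
    (Measure.measure_univ_ne_zero.mpr (Measure.toSphere_ne_zero _)) (measure_ne_top _ _)

theorem ae_norm_eq_one_uniformSphere : ∀ᵐ x ∂uniformSphere d, ‖x‖ = 1 := by
  rw [uniformSphere, ae_map_iff measurable_subtype_coe.aemeasurable
    (measurableSet_eq_fun measurable_norm measurable_const)]
  exact Filter.Eventually.of_forall fun x => by simp

/-- `toSphere` measures a set by the volume of the cone over it, and Lebesgue measure is invariant
under negation. This symmetry makes the uniform measure centered. -/
theorem measurePreserving_neg_toSphere :
    MeasurePreserving (fun x : sphere (0 : EuclideanSpace ℝ (Fin d)) 1 => -x)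
      (volume : Measure (EuclideanSpace ℝ (Fin d))).toSphere
      (volume : Measure (EuclideanSpace ℝ (Fin d))).toSphere := by
  have hm : Measurable (fun x : sphere (0 : EuclideanSpace ℝ (Fin d)) 1 => -x) :=
    continuous_neg.measurable
  refine ⟨hm, Measure.ext fun s hs => ?_⟩
  rw [Measure.map_apply hm hs, Measure.toSphere_apply' _ hs, Measure.toSphere_apply' _ (hm hs)]
  congr 1
  rw [← Measure.measure_neg]
  congr 1
  ext x
  simp only [Set.mem_neg, Set.mem_smul, Set.mem_image, Set.mem_preimage]
  constructor
  · rintro ⟨r, hr, _, ⟨y, hy, rfl⟩, h⟩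
    exact ⟨r, hr, _, ⟨-y, hy, rfl⟩, by simp [h]⟩
  · rintro ⟨r, hr, _, ⟨y, hy, rfl⟩, h⟩
    exact ⟨r, hr, _, ⟨-y, by simpa using hy, rfl⟩, by simp [h]⟩

theorem integral_coord_uniformSphere (i : Fin d) : ∫ x, x i ∂uniformSphere d = 0 := by
  rw [uniformSphere, integral_map measurable_subtype_coe.aemeasurable
    (Measurable.aestronglyMeasurable (by fun_prop)), integral_smul_measure]
  have h := measurePreserving_neg_toSphere.integral_comp
    (Homeomorph.neg (sphere (0 : EuclideanSpace ℝ (Fin d)) 1)).measurableEmbedding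
    (fun x => x.1 i)
  have h' : ∫ x : sphere (0 : EuclideanSpace ℝ (Fin d)) 1, x.1 i ∂volume.toSphere = 0 := by
    simp only [coe_neg_sphere, PiLp.neg_apply, integral_neg] at h
    linarith
  rw [h', smul_zero]

theorem support_uniformSphere : (uniformSphere d).support = sphere 0 1 := by
  refine subset_antisymm (Measure.support_subset_of_isClosed isClosed_sphere ?_) fun x hx => ?_
  · filter_upwards [ae_norm_eq_one_uniformSphere] with x hx
    simpa using hx
  · rw [Measure.mem_support_iff_forall]
    intro U hU
    obtain ⟨V, hVU, hV, hxV⟩ := _root_.mem_nhds_iff.mp hU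
    refine lt_of_lt_of_le ?_ (measure_mono hVU)
    rw [uniformSphere, Measure.map_apply measurable_subtype_coe hV.measurableSet,
      Measure.smul_apply, smul_eq_mul]
    refine ENNReal.mul_pos (ENNReal.inv_ne_zero.mpr (measure_ne_top _ _)) ?_
    exact (hV.preimage continuous_subtype_val).measure_ne_zero _ ⟨⟨x, hx⟩, hxV⟩

/-- A map between unit spheres that preserves squared distances does not lower the dimension. -/
theorem le_of_sqEuclidean_preserving {e : ℕ}
    (f : sphere (0 : EuclideanSpace ℝ (Fin d)) 1 → EuclideanSpace ℝ (Fin e))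
    (hf1 : ∀ x, ‖f x‖ = 1) (hf : ∀ x x' : sphere (0 : EuclideanSpace ℝ (Fin d)) 1,
      sqEuclidean d x x' = sqEuclidean e (f x) (f x')) :
    d ≤ e := by
  have hinner : ∀ x x' : sphere (0 : EuclideanSpace ℝ (Fin d)) 1,
      inner ℝ x.1 x'.1 = inner ℝ (f x) (f x') := by
    intro x x'
    have h := hf x x'
    rw [sqEuclidean_eq_of_norm_eq_one (by simp) (by simp),
      sqEuclidean_eq_of_norm_eq_one (hf1 _) (hf1 _)] at h
    linarith
  -- Linearity of `f` is not needed: the images of the basis vectors are already orthonormal, hence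
  -- independent.
  let b := EuclideanSpace.basisFun (Fin d) ℝ
  have ho : Orthonormal ℝ fun i => f ⟨b i, by simp⟩ := by
    rw [orthonormal_iff_ite]
    intro i j
    rw [← hinner]
    exact orthonormal_iff_ite.mp b.orthonormal i j
  simpa using ho.linearIndependent.fintype_card_le_finrank

theorem le_of_areIsometric {d e : ℕ} (h : AreIsometric (sqEuclidean d) (sqEuclidean e)
    (uniformSphere d) (uniformSphere e)) : d ≤ e ∧ e ≤ d := by
  obtain ⟨I, hI, -⟩ := h
  have hs : ∀ {n : ℕ} (x : (uniformSphere n).support), ‖x.1‖ = 1 := fun x =>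
    mem_sphere_zero_iff_norm.mp (support_uniformSphere.subset x.2)
  have hm : ∀ {n : ℕ} (x : sphere (0 : EuclideanSpace ℝ (Fin n)) 1),
      x.1 ∈ (uniformSphere n).support := fun x => support_uniformSphere.superset x.2
  constructor
  · exact le_of_sqEuclidean_preserving (fun x => (I ⟨x.1, hm x⟩).1)
      (fun x => hs (I ⟨x.1, hm x⟩)) (fun x x' => hI ⟨x.1, hm x⟩ ⟨x'.1, hm x'⟩)
  · refine le_of_sqEuclidean_preserving (fun y => (I.symm ⟨y.1, hm y⟩).1)
      (fun y => hs (I.symm ⟨y.1, hm y⟩)) (fun y y' => ?_)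
    have h := hI (I.symm ⟨y.1, hm y⟩) (I.symm ⟨y'.1, hm y'⟩)
    rw [I.apply_symm_apply, I.apply_symm_apply] at h
    exact h.symm

end UniformSphere

end SinkhornGW

theorem mainTheorem4 (D E : ℕ) (hD : 1 ≤ D) (hE : 1 ≤ E) (hDE : D ≠ E) :
    ¬ SinkhornGW.AreIsometric (SinkhornGW.sqEuclidean D) (SinkhornGW.sqEuclidean E)
        (SinkhornGW.uniformSphere D) (SinkhornGW.uniformSphere E) ∧
      ∃ ε₀ : ℝ, 0 < ε₀ ∧ ∀ ε : ℝ, ε₀ < ε →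
        SinkhornGW.sinkhornGW (SinkhornGW.sqEuclidean D) (SinkhornGW.sqEuclidean E) ε
          (SinkhornGW.uniformSphere D) (SinkhornGW.uniformSphere E) = 0 := by
  have := SinkhornGW.isProbabilityMeasure_uniformSphere hD
  have := SinkhornGW.isProbabilityMeasure_uniformSphere hE
  have hpos : (0 : ℝ) < 32 * ((D : ℝ) + E) ^ 2 := by
    have : (1 : ℝ) ≤ D := by exact_mod_cast hD
    positivity
  refine ⟨fun h => hDE ?_, 32 * ((D : ℝ) + E) ^ 2, hpos, fun ε hε => ?_⟩
  · exact le_antisymm (SinkhornGW.le_of_areIsometric h).1 (SinkhornGW.le_of_areIsometric h).2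
  · exact SinkhornGW.sinkhornGW_eq_zero SinkhornGW.ae_norm_eq_one_uniformSphere
      SinkhornGW.ae_norm_eq_one_uniformSphere SinkhornGW.integral_coord_uniformSphere
      SinkhornGW.integral_coord_uniformSphere (hpos.trans hε) hε.le
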